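/- Let $(Q,\cdot,\backslash,/)$ be a (nonempty) quasigroup, i.e. the identities $x\cdot(x\backslash y)=y$, $(y/x)\cdot x=y$, $x\backslash(x\cdot y)=y$, $(y\cdot x)/x=y$ hold. A congruence $V$ of $(Q,\cdot,\backslash,/)$, regarded as a subquasigroup of $Q\times Q$, is called central if the diagonal $\{(q,q)\mid q\in Q\}$ is a normal subquasigroup of $V$, i.e. an equivalence class of some congruence of the quasigroup $V$. A center of $Q$ is a class of the greatest central congruence of $Q$, and $Q$ is central (in the sense of Belyavskaya and Smith) if it coincides with its center. An autotopy of $Q$ is a triple $(\alpha,\beta,\gamma)$ of permutations of $Q$ with $\alpha x\cdot\beta y=\gamma(x\cdot y)$ for all $x,y\in Q$; autotopies form a group under componentwise composition. Let $N^A_l$, $N^A_m$, $N^A_r$ be the subgroups of the autotopies of the form $(\alpha,\varepsilon,\gamma)$, $(\alpha,\beta,\varepsilon)$, $(\varepsilon,\beta,\gamma)$, respectively, where $\varepsilon$ is the identity map. The left, right and middle A-centers of $Q$ are $$Z^A_l=(N^A_r\times N^A_m)\cap N^A_l,\qquad Z^A_r=(N^A_l\times N^A_m)\cap N^A_r,\qquad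 Z^A_m=(N^A_l\times N^A_r)\cap N^A_m ,$$ where $\times$ is the internal direct product in the autotopy group. Their components are the permutation groups ${}_1Z^A_l$, ${}_3Z^A_l$, ${}_2Z^A_r$, ${}_3Z^A_r$, ${}_1Z^A_m$, ${}_2Z^A_m$, where ${}_iZ$ is the group of the $i$-th components of the elements of $Z$. The quasigroup $Q$ is A-central if at least one of these components acts transitively on $Q$. Then every quasigroup that is central in the sense of Belyavskaya and Smith is A-central. -/

import Mathlib

/-- A quasigroup `(Q, ·, \, /)`; `ldiv x y` is `x \ y` and `rdiv y x` is `y / x`. -/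
class QGroup (Q : Type*) extends Mul Q where
  ldiv : Q → Q → Q
  rdiv : Q → Q → Q
  mul_ldiv : ∀ x y : Q, x * ldiv x y = y
  rdiv_mul : ∀ x y : Q, rdiv y x * x = y
  ldiv_mul : ∀ x y : Q, ldiv x (x * y) = y
  mul_rdiv : ∀ x y : Q, rdiv (y * x) x = y

namespace QGroup

/-- A congruence of the quasigroup `(Q, ·, \, /)`. -/
structure Congruence (Q : Type*) [QGroup Q] extends Setoid Q where
  mul_compat : ∀ {a b c d : Q}, r a b → r c d → r (a * c) (b * d)
  ldiv_compat : ∀ {a b c d : Q}, r a b → r c d → r (ldiv a c) (ldiv b d)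
  rdiv_compat : ∀ {a b c d : Q}, r a b → r c d → r (rdiv a c) (rdiv b d)

section Center

variable {Q : Type*} [QGroup Q]

/-- The elements `(fst, snd)` of a congruence `V`, regarded as a subset of `Q × Q`. -/
@[ext]
structure Congruence.Pairs (V : Congruence Q) where
  fst : Q
  snd : Q
  rel : V.r fst snd

/-- A congruence `V` of `Q`, as a subquasigroup of `Q × Q` with componentwise operations. -/
instance Congruence.instPairs (V : Congruence Q) : QGroup V.Pairs where
  mul p q := ⟨p.fst * q.fst, p.snd * q.snd, V.mul_compat p.rel q.rel⟩
  ldiv p q := ⟨ldiv p.fst q.fst, ldiv p.snd q.snd, V.ldiv_compat p.rel q.rel⟩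
  rdiv p q := ⟨rdiv p.fst q.fst, rdiv p.snd q.snd, V.rdiv_compat p.rel q.rel⟩
  mul_ldiv _ _ := Congruence.Pairs.ext (mul_ldiv _ _) (mul_ldiv _ _)
  rdiv_mul _ _ := Congruence.Pairs.ext (rdiv_mul _ _) (rdiv_mul _ _)
  ldiv_mul _ _ := Congruence.Pairs.ext (ldiv_mul _ _) (ldiv_mul _ _)
  mul_rdiv _ _ := Congruence.Pairs.ext (mul_rdiv _ _) (mul_rdiv _ _)

/-- The diagonal `{(q, q) | q ∈ Q}` of a congruence. -/
def Congruence.diagonal (V : Congruence Q) : Set V.Pairs := {p | p.fst = p.snd}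

/-- A congruence `V` is central if the diagonal is a normal subquasigroup of `V`, that is, a
class of some congruence of the quasigroup `V`. -/
def Congruence.IsCentral (V : Congruence Q) : Prop :=
  ∃ θ : Congruence V.Pairs, V.diagonal ∈ θ.toSetoid.classes

/-- The center congruence: the greatest central congruence. -/
def Congruence.IsCenterCongruence (V : Congruence Q) : Prop :=
  V.IsCentral ∧ ∀ W : Congruence Q, W.IsCentral → ∀ x y : Q, W.r x y → V.r x y

/-- `Z` is a center of `Q`: a class of the center congruence. -/
def IsCenter (Z : Set Q) : Prop :=
  ∃ V : Congruence Q, V.IsCenterCongruence ∧ Z ∈ V.toSetoid.classes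

end Center

/-- A quasigroup is central if it coincides with its center. -/
def IsCentral (Q : Type*) [QGroup Q] : Prop := IsCenter (Set.univ : Set Q)

section Autotopy

variable (Q : Type*) [QGroup Q]

/-- The autotopy group: triples `(α, β, γ)` of permutations of `Q` with
`α x · β y = γ (x · y)`, multiplied componentwise. -/
def Avt : Subgroup (Equiv.Perm Q × Equiv.Perm Q × Equiv.Perm Q) where
  carrier := {T | ∀ x y : Q, T.1 x * T.2.1 y = T.2.2 (x * y)}
  one_mem' _ _ := rfl
  mul_mem' {S T} hS hT x y := (hS (T.1 x) (T.2.1 y)).trans (congrArg S.2.2 (hT x y))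
  inv_mem' {T} hT x y := T.2.2.injective <| by
    have h := hT (T.1.symm x) (T.2.1.symm y)
    rw [Equiv.apply_symm_apply, Equiv.apply_symm_apply] at h
    exact h.symm.trans (Equiv.apply_symm_apply T.2.2 (x * y)).symm

/-- First component of a triple. -/
def comp₁ : Equiv.Perm Q × Equiv.Perm Q × Equiv.Perm Q →* Equiv.Perm Q :=
  MonoidHom.fst _ _

/-- Second component of a triple. -/
def comp₂ : Equiv.Perm Q × Equiv.Perm Q × Equiv.Perm Q →* Equiv.Perm Q :=
  (MonoidHom.fst _ _).comp (MonoidHom.snd _ _)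

/-- Third component of a triple. -/
def comp₃ : Equiv.Perm Q × Equiv.Perm Q × Equiv.Perm Q →* Equiv.Perm Q :=
  (MonoidHom.snd _ _).comp (MonoidHom.snd _ _)

/-- The left A-nucleus: autotopies of the form `(α, ε, γ)`. -/
def leftANucleus : Subgroup (Equiv.Perm Q × Equiv.Perm Q × Equiv.Perm Q) :=
  Avt Q ⊓ (comp₂ Q).ker

/-- The right A-nucleus: autotopies of the form `(ε, β, γ)`. -/
def rightANucleus : Subgroup (Equiv.Perm Q × Equiv.Perm Q × Equiv.Perm Q) :=
  Avt Q ⊓ (comp₁ Q).ker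

/-- The middle A-nucleus: autotopies of the form `(α, β, ε)`. -/
def middleANucleus : Subgroup (Equiv.Perm Q × Equiv.Perm Q × Equiv.Perm Q) :=
  Avt Q ⊓ (comp₃ Q).ker

/-- The left A-center. Any two A-nuclei commute elementwise and meet trivially, so that their
join is their internal direct product. -/
def leftACenter : Subgroup (Equiv.Perm Q × Equiv.Perm Q × Equiv.Perm Q) :=
  (rightANucleus Q ⊔ middleANucleus Q) ⊓ leftANucleus Q

/-- The right A-center. -/
def rightACenter : Subgroup (Equiv.Perm Q × Equiv.Perm Q × Equiv.Perm Q) :=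
  (leftANucleus Q ⊔ middleANucleus Q) ⊓ rightANucleus Q

/-- The middle A-center. -/
def middleACenter : Subgroup (Equiv.Perm Q × Equiv.Perm Q × Equiv.Perm Q) :=
  (leftANucleus Q ⊔ rightANucleus Q) ⊓ middleANucleus Q

/-- A quasigroup is A-central if at least one of the component groups of its A-centers acts
transitively on it. -/
def IsACentral : Prop :=
  MulAction.IsPretransitive ((leftACenter Q).map (comp₁ Q)) Q ∨
  MulAction.IsPretransitive ((leftACenter Q).map (comp₃ Q)) Q ∨
  MulAction.IsPretransitive ((rightACenter Q).map (comp₂ Q)) Q ∨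
  MulAction.IsPretransitive ((rightACenter Q).map (comp₃ Q)) Q ∨
  MulAction.IsPretransitive ((middleACenter Q).map (comp₁ Q)) Q ∨
  MulAction.IsPretransitive ((middleACenter Q).map (comp₂ Q)) Q

end Autotopy

end QGroup

/-! If the center is all of `Q`, a congruence `θ` of `Q × Q` has the diagonal as a class, and `(a,
b) θ (c, d)` behaves like equality of vectors: given `a`, `b`, `c` there is exactly one `d`, namely
`malcev b a c` (`rel_malcev`, `eq_of_rel`). The resulting translations form autotopies because `θ`
respects products; suitable ones lie in the left A-center, and their first components move any `a`
to any `b`. -/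

namespace QGroup

section Malcev

variable {Q : Type*} [QGroup Q]

/-- The Maltsev term `(x / (y \ y)) · (y \ z)` of quasigroups. -/
def malcev (x y z : Q) : Q := rdiv x (ldiv y y) * ldiv y z

theorem malcev_right (x y : Q) : malcev x y y = x := rdiv_mul _ _

theorem malcev_left (x z : Q) : malcev x x z = z := by
  have h : rdiv x (ldiv x x) = x := by
    simpa only [mul_ldiv] using mul_rdiv (ldiv x x) x
  rw [malcev, h, mul_ldiv]

theorem Congruence.malcev_compat (θ : Congruence Q) {a b c d e f : Q}
    (h₁ : θ.r a b) (h₂ : θ.r c d) (h₃ : θ.r e f) : θ.r (malcev a c e) (malcev b d f) :=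
  θ.mul_compat (θ.rdiv_compat h₁ (θ.ldiv_compat h₂ h₂)) (θ.ldiv_compat h₂ h₃)

end Malcev

section Translation

variable {Q : Type*} [QGroup Q] {V : Congruence Q} (θ : Congruence V.Pairs)

/-- The diagonal is a class of `θ`, in terms of elements. -/
def DiagonalIsClass : Prop :=
  (∀ p q : V.Pairs, p.fst = p.snd → q.fst = q.snd → θ.r p q) ∧
    ∀ p q : V.Pairs, p.fst = p.snd → θ.r p q → q.fst = q.snd

theorem diagonalIsClass_of_mem_classes
    (h : V.diagonal ∈ θ.toSetoid.classes) : DiagonalIsClass θ := by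
  obtain ⟨d, hd⟩ := h
  have key : ∀ p : V.Pairs, p.fst = p.snd ↔ θ.r p d := fun p => Set.ext_iff.mp hd p
  exact ⟨fun p q hp hq => θ.trans' ((key p).1 hp) (θ.symm' ((key q).1 hq)),
    fun p q hp h => (key q).2 (θ.trans' (θ.symm' h) ((key p).1 hp))⟩

variable {θ}

/-- Apply the Maltsev term to `(a, b)`, `(a, a)` and the related pairs `(a, a) θ (c, c)`. -/
theorem DiagonalIsClass.rel_malcev (hθ : DiagonalIsClass θ) {a b : Q} (hab : V.r a b)
    {c : Q} (h : V.r c (malcev b a c)) : θ.r ⟨a, b, hab⟩ ⟨c, malcev b a c, h⟩ := by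
  have := θ.malcev_compat (θ.refl' (⟨a, b, hab⟩ : V.Pairs))
    (θ.refl' (⟨a, a, V.refl' a⟩ : V.Pairs))
    (hθ.1 ⟨a, a, V.refl' a⟩ ⟨c, c, V.refl' c⟩ rfl rfl)
  rw [malcev_right] at this
  convert this using 1
  exact Congruence.Pairs.ext (malcev_left a c).symm rfl

/-- The Maltsev term with `(c, d')` and `(d', d')` in the last two places sends `(c, d)` to `(d',
d)` and `(c, d')` to the diagonal pair `(d', d')`. -/
theorem DiagonalIsClass.eq_of_rel (hθ : DiagonalIsClass θ) {c d d' : Q}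
    (hd : V.r c d) (hd' : V.r c d') (h : θ.r ⟨c, d, hd⟩ ⟨c, d', hd'⟩) : d = d' := by
  have := θ.malcev_compat h (θ.refl' (⟨c, d', hd'⟩ : V.Pairs))
    (θ.refl' (⟨d', d', V.refl' d'⟩ : V.Pairs))
  rw [malcev_left] at this
  have h' : malcev c c d' = malcev d d' d' := hθ.2 _ _ rfl (θ.symm' this)
  rw [malcev_left, malcev_right] at h'
  exact h'.symm

/-- `(b, a)` is the Maltsev term of `(b, b)`, `(a, b)`, `(a, a)`. -/
theorem DiagonalIsClass.rel_swap (hθ : DiagonalIsClass θ) {a b c d : Q}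
    (hab : V.r a b) (hcd : V.r c d) (h : θ.r ⟨a, b, hab⟩ ⟨c, d, hcd⟩) :
    θ.r ⟨b, a, V.symm' hab⟩ ⟨d, c, V.symm' hcd⟩ := by
  have := θ.malcev_compat (hθ.1 ⟨b, b, V.refl' b⟩ ⟨d, d, V.refl' d⟩ rfl rfl) h
    (hθ.1 ⟨a, a, V.refl' a⟩ ⟨c, c, V.refl' c⟩ rfl rfl)
  convert this using 1
  · exact Congruence.Pairs.ext (malcev_right b a).symm (malcev_left b a).symm
  · exact Congruence.Pairs.ext (malcev_right d c).symm (malcev_left d c).symm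

/-- The permutation of `Q` sending `x` to the unique `y` with `(a, b)` related to `(x, y)`. -/
def DiagonalIsClass.translation (hθ : DiagonalIsClass θ) (hV : ∀ x y, V.r x y)
    (a b : Q) : Equiv.Perm Q where
  toFun x := malcev b a x
  invFun y := malcev a b y
  left_inv x := by
    -- With `y = malcev b a x`, both `(y, x)` and `(y, malcev a b y)` are related to `(b, a)`, so
    -- uniqueness applies.
    have h₁ := hθ.rel_swap _ _ (hθ.rel_malcev (hV a b) (hV x (malcev b a x)))
    have h₂ := hθ.rel_malcev (hV b a) (hV (malcev b a x) (malcev a b (malcev b a x)))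
    exact hθ.eq_of_rel _ _ (θ.trans' (θ.symm' h₂) h₁)
  right_inv x := by
    have h₁ := hθ.rel_swap _ _ (hθ.rel_malcev (hV b a) (hV x (malcev a b x)))
    have h₂ := hθ.rel_malcev (hV a b) (hV (malcev a b x) (malcev b a (malcev a b x)))
    exact hθ.eq_of_rel _ _ (θ.trans' (θ.symm' h₂) h₁)

variable (hθ : DiagonalIsClass θ) (hV : ∀ x y, V.r x y)

theorem DiagonalIsClass.translation_left (a b : Q) :
    hθ.translation hV a b a = b := malcev_right b a

theorem DiagonalIsClass.translation_self (a : Q) :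
    hθ.translation hV a a = 1 := Equiv.ext fun x => malcev_left a x

theorem DiagonalIsClass.translation_mem_Avt (a b c d : Q) :
    (hθ.translation hV a b, hθ.translation hV c d, hθ.translation hV (a * c) (b * d)) ∈ Avt Q := by
  intro x y
  have h₁ := θ.mul_compat (hθ.rel_malcev (hV a b) (hV x (malcev b a x)))
    (hθ.rel_malcev (hV c d) (hV y (malcev d c y)))
  have h₂ := hθ.rel_malcev (hV (a * c) (b * d)) (hV (x * y) (malcev (b * d) (a * c) (x * y)))
  exact hθ.eq_of_rel (hV _ _) _ (θ.trans' (θ.symm' h₁) h₂)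

theorem DiagonalIsClass.translation_mem_leftACenter (a b c : Q) :
    (hθ.translation hV a b, 1, hθ.translation hV (a * c) (b * c)) ∈ leftACenter Q := by
  have hl : (hθ.translation hV a b, 1, hθ.translation hV (a * c) (b * c)) ∈ Avt Q := by
    simpa only [hθ.translation_self] using hθ.translation_mem_Avt hV a b c c
  -- The point `ldiv a (b * c)` makes the third component agree with that of `hl`.
  have hr : (1, hθ.translation hV c (ldiv a (b * c)), hθ.translation hV (a * c) (b * c))
      ∈ Avt Q := by
    simpa only [hθ.translation_self, mul_ldiv] using
      hθ.translation_mem_Avt hV a a c (ldiv a (b * c))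
  refine ⟨?_, hl, rfl⟩
  -- Dividing by the right-nucleus triple cancels the third component, leaving a middle-nucleus
  -- factor.
  rw [← mul_inv_cancel_left (1, hθ.translation hV c (ldiv a (b * c)),
    hθ.translation hV (a * c) (b * c)) (hθ.translation hV a b, 1, _)]
  exact Subgroup.mul_mem_sup ⟨hr, rfl⟩
    ⟨(Avt Q).mul_mem ((Avt Q).inv_mem hr) hl, inv_mul_cancel (hθ.translation hV (a * c) (b * c))⟩

end Translation

end QGroup

theorem mainTheorem4 (Q : Type*) [QGroup Q] [Nonempty Q] (hQ : QGroup.IsCentral Q) :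
    QGroup.IsACentral Q := by
  obtain ⟨V, ⟨⟨θ, hclass⟩, -⟩, v, hv⟩ := hQ
  -- A congruence with the whole of `Q` as a class is total.
  have hV : ∀ x y, V.r x y := fun x y =>
    V.trans' ((Set.ext_iff.mp hv x).1 trivial) (V.symm' ((Set.ext_iff.mp hv y).1 trivial))
  have hθ := QGroup.diagonalIsClass_of_mem_classes θ hclass
  exact Or.inl ⟨fun x y => ⟨⟨hθ.translation hV x y, _,
    hθ.translation_mem_leftACenter hV x y x, rfl⟩, hθ.translation_left hV x y⟩⟩
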